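/- Let $\varphi(t)=\frac{1}{\sqrt{2\pi}}e^{-t^2/2}$, $\Phi(t)=\int_{-\infty}^t\varphi(s)\,ds$, and let $I:[0,1]\to\mathbb R$ be given by $I(x)=\varphi(\Phi^{-1}(x))$ for $0<x<1$ and $I(0)=I(1)=0$. Let $n\ge 0$ be an integer and let $\gamma^n$ be the standard Gaussian measure on $\mathbb R^n$, $d\gamma^n(x)=(2\pi)^{-n/2}e^{-|x|^2/2}\,dx$, where $|\cdot|$ is the Euclidean norm. Then for every continuously differentiable function $f:\mathbb R^n\to[0,1]$, $$\int_{\mathbb R^n}\sqrt{I(f)^2+|\nabla f|^2}\,d\gamma^n\;\ge\; I\!\left(\int_{\mathbb R^n} f\,d\gamma^n\right),$$ where the left-hand side is the integral of a nonnegative measurable function and may be $+\infty$. -/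

import Mathlib

open MeasureTheory ProbabilityTheory Set Filter Topology
open scoped Gradient

noncomputable section

/-- The density `φ(t) = exp(-t²/2) / √(2π)` of the standard Gaussian measure on `ℝ`. -/
def stdNormalPDF (t : ℝ) : ℝ := Real.exp (-t ^ 2 / 2) / Real.sqrt (2 * Real.pi)

/-- The distribution function `Φ(t) = γ((-∞, t])` of the standard Gaussian measure on `ℝ`. -/
def stdNormalCDF (t : ℝ) : ℝ := (gaussianReal 0 1).real (Iic t)

/-- The inverse `Φ⁻¹` of the bijection `Φ : ℝ → (0,1)`; only its values on `(0,1)` matter, see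
`stdNormalCDF_quantile` and `stdNormalQuantile_cdf`. -/
def stdNormalQuantile (x : ℝ) : ℝ := Function.invFun stdNormalCDF x

/-- The Gaussian isoperimetric profile `I = φ ∘ Φ⁻¹` on `(0,1)`, extended by the usual convention
`I(0) = φ(-∞) = 0`, `I(1) = φ(+∞) = 0` (and by `0` outside `[0,1]`, which is immaterial). -/
def gaussianProfile (x : ℝ) : ℝ :=
  open Classical in if x ∈ Ioo (0 : ℝ) 1 then stdNormalPDF (stdNormalQuantile x) else 0

theorem stdNormalPDF_eq (t : ℝ) : stdNormalPDF t = gaussianPDFReal 0 1 t := by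
  simp [stdNormalPDF, gaussianPDFReal, div_eq_inv_mul]

/-- `φ = Φ'`. -/
theorem hasDerivAt_stdNormalCDF (t : ℝ) : HasDerivAt stdNormalCDF (stdNormalPDF t) t := by
  have hc : Continuous (gaussianPDFReal 0 1) := by
    have : gaussianPDFReal 0 1 = stdNormalPDF := funext fun s => (stdNormalPDF_eq s).symm
    rw [this]
    unfold stdNormalPDF
    fun_prop
  have hi : Integrable (gaussianPDFReal 0 1) volume := integrable_gaussianPDFReal 0 1
  have h : stdNormalCDF = fun s => stdNormalCDF 0 + ∫ x in (0 : ℝ)..s, gaussianPDFReal 0 1 x := by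
    have key : ∀ s, stdNormalCDF s = ∫ x in Iic s, gaussianPDFReal 0 1 x := by
      intro s
      rw [stdNormalCDF, measureReal_def, gaussianReal_apply_eq_integral 0 one_ne_zero,
        ENNReal.toReal_ofReal]
      exact integral_nonneg fun x => gaussianPDFReal_nonneg 0 1 x
    funext s
    rw [key s, key 0, ← intervalIntegral.integral_Iic_sub_Iic hi.integrableOn hi.integrableOn]
    ring
  rw [h, stdNormalPDF_eq]
  exact (intervalIntegral.integral_hasDerivAt_right (hc.intervalIntegrable _ _)
    hc.stronglyMeasurable.stronglyMeasurableAtFilter hc.continuousAt).const_add _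

theorem strictMono_stdNormalCDF : StrictMono stdNormalCDF := by
  refine strictMono_of_deriv_pos fun t => ?_
  rw [(hasDerivAt_stdNormalCDF t).deriv, stdNormalPDF]
  positivity

theorem stdNormalQuantile_cdf (t : ℝ) : stdNormalQuantile (stdNormalCDF t) = t :=
  Function.leftInverse_invFun strictMono_stdNormalCDF.injective t

theorem stdNormalCDF_quantile {x : ℝ} (hx : x ∈ Ioo (0 : ℝ) 1) :
    stdNormalCDF (stdNormalQuantile x) = x := by
  have e : stdNormalCDF = cdf (gaussianReal 0 1) := funext fun t => (cdf_eq_real _ t).symm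
  have hcont : Continuous stdNormalCDF :=
    continuous_iff_continuousAt.2 fun t => (hasDerivAt_stdNormalCDF t).continuousAt
  have h0 : Tendsto stdNormalCDF atBot (𝓝 0) := e ▸ tendsto_cdf_atBot _
  have h1 : Tendsto stdNormalCDF atTop (𝓝 1) := e ▸ tendsto_cdf_atTop _
  obtain ⟨a, ha⟩ := (h0.eventually (gt_mem_nhds hx.1)).exists
  obtain ⟨b, hb⟩ := (h1.eventually (lt_mem_nhds hx.2)).exists
  exact Function.invFun_eq (mem_range_of_exists_le_of_exists_ge hcont ⟨a, ha.le⟩ ⟨b, hb.le⟩)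

theorem gaussianProfile_stdNormalCDF (t : ℝ) :
    gaussianProfile (stdNormalCDF t) = stdNormalPDF t := by
  have h : stdNormalCDF t ∈ Ioo (0 : ℝ) 1 :=
    ⟨lt_of_le_of_lt measureReal_nonneg (strictMono_stdNormalCDF (sub_one_lt t)),
      lt_of_lt_of_le (strictMono_stdNormalCDF (lt_add_one t)) measureReal_le_one⟩
  rw [gaussianProfile, if_pos h, stdNormalQuantile_cdf]

end

/-! This is Bobkov's argument: a two-point inequality, tensorised along a sign walk, passes to the
Gaussian limit.

On `(0,1)` write `q = Φ⁻¹`. Then `q' = 1/I` and `I' = -q`, so `(I²)'' = 2q² - 2` and `(q²)'' = 2(1 +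
q²)/I² ≥ 0`. These formulas and the symmetry of `I` about `1/2` reduce the two-point inequality
`two_mul_gaussianProfile_le` to second-derivative comparisons on a half-interval.

Replacing `f` by its average over `x ± v` costs one application of that inequality; Minkowski's
inequality carries along the increments in the other directions. Induction on the list of steps
gives `gaussianProfile_walkAverage_le`.

With `m` steps `eᵢ/√m` in each direction, the walk converges weakly to the standard Gaussian, and
the squared directional derivatives along the steps sum exactly to `|∇f|²`. For compactly supported
`f`, uniform continuity of the derivative controls the finite differences. A smooth cutoff and
dominated convergence remove the compact support when the right-hand integral is finite; otherwise
there is nothing to prove. -/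

/-! ### Calculus of the normal density, the quantile and the profile -/

theorem stdNormalPDF_pos (t : ℝ) : 0 < stdNormalPDF t := by
  unfold stdNormalPDF; positivity

theorem stdNormalPDF_le_of_abs_le {s t : ℝ} (h : |s| ≤ |t|) : stdNormalPDF t ≤ stdNormalPDF s := by
  have := sq_le_sq.2 h
  unfold stdNormalPDF
  gcongr

theorem stdNormalPDF_neg (t : ℝ) : stdNormalPDF (-t) = stdNormalPDF t := by
  simp [stdNormalPDF]

theorem hasDerivAt_stdNormalPDF (t : ℝ) : HasDerivAt stdNormalPDF (-t * stdNormalPDF t) t := by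
  have h : HasDerivAt (fun t : ℝ => -t ^ 2 / 2) (-t) t := by
    refine (((hasDerivAt_pow 2 t).neg).div_const 2).congr_deriv ?_
    norm_num
    ring
  refine (h.exp.div_const (Real.sqrt (2 * Real.pi))).congr_deriv ?_
  unfold stdNormalPDF
  ring

theorem tendsto_stdNormalPDF_atTop : Tendsto stdNormalPDF atTop (𝓝 0) := by
  have h : Tendsto (fun t : ℝ => -(t ^ 2) / 2) atTop atBot :=
    (tendsto_neg_atTop_atBot.comp (tendsto_pow_atTop two_ne_zero)).atBot_div_const two_pos
  have := (Real.tendsto_exp_atBot.comp h).div_const (Real.sqrt (2 * Real.pi))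
  rwa [zero_div] at this

theorem stdNormalCDF_mem_Ioo (t : ℝ) : stdNormalCDF t ∈ Ioo (0 : ℝ) 1 :=
  ⟨lt_of_le_of_lt measureReal_nonneg (strictMono_stdNormalCDF (sub_one_lt t)),
    lt_of_lt_of_le (strictMono_stdNormalCDF (lt_add_one t)) measureReal_le_one⟩

theorem stdNormalCDF_neg (t : ℝ) : stdNormalCDF (-t) = 1 - stdNormalCDF t := by
  have e : stdNormalCDF = cdf (gaussianReal 0 1) := funext fun t => (cdf_eq_real _ t).symm
  have hd (s : ℝ) : HasDerivAt (fun s => stdNormalCDF s + stdNormalCDF (-s)) 0 s := by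
    refine ((hasDerivAt_stdNormalCDF s).add
      ((hasDerivAt_stdNormalCDF (-s)).comp s (hasDerivAt_neg s))).congr_deriv ?_
    rw [stdNormalPDF_neg]; ring
  have hc (s : ℝ) : stdNormalCDF t + stdNormalCDF (-t) = stdNormalCDF s + stdNormalCDF (-s) :=
    is_const_of_deriv_eq_zero (fun s => (hd s).differentiableAt) (fun s => (hd s).deriv) t s
  have h0 : Tendsto (fun s => stdNormalCDF s + stdNormalCDF (-s)) atTop (𝓝 (1 + 0)) := by
    rw [e]
    exact (tendsto_cdf_atTop _).add ((tendsto_cdf_atBot _).comp tendsto_neg_atTop_atBot)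
  have h1 := tendsto_nhds_unique
    ((tendsto_congr hc).1 (tendsto_const_nhds (x := stdNormalCDF t + stdNormalCDF (-t)))) h0
  linarith

theorem strictMonoOn_stdNormalQuantile : StrictMonoOn stdNormalQuantile (Ioo 0 1) := by
  intro x hx y hy h
  rwa [← strictMono_stdNormalCDF.lt_iff_lt, stdNormalCDF_quantile hx, stdNormalCDF_quantile hy]

theorem stdNormalQuantile_one_sub {x : ℝ} (hx : x ∈ Ioo (0 : ℝ) 1) :
    stdNormalQuantile (1 - x) = -stdNormalQuantile x := by
  rw [← stdNormalQuantile_cdf (-stdNormalQuantile x), stdNormalCDF_neg, stdNormalCDF_quantile hx]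

theorem gaussianProfile_of_mem {x : ℝ} (hx : x ∈ Ioo (0 : ℝ) 1) :
    gaussianProfile x = stdNormalPDF (stdNormalQuantile x) := by
  rw [gaussianProfile, if_pos hx]

theorem gaussianProfile_of_notMem {x : ℝ} (hx : x ∉ Ioo (0 : ℝ) 1) : gaussianProfile x = 0 := by
  rw [gaussianProfile, if_neg hx]

theorem gaussianProfile_pos {x : ℝ} (hx : x ∈ Ioo (0 : ℝ) 1) : 0 < gaussianProfile x := by
  rw [gaussianProfile_of_mem hx]
  exact stdNormalPDF_pos _

theorem gaussianProfile_nonneg (x : ℝ) : 0 ≤ gaussianProfile x := by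
  by_cases hx : x ∈ Ioo (0 : ℝ) 1
  · exact (gaussianProfile_pos hx).le
  · rw [gaussianProfile_of_notMem hx]

theorem gaussianProfile_le (x : ℝ) : gaussianProfile x ≤ stdNormalPDF 0 := by
  by_cases hx : x ∈ Ioo (0 : ℝ) 1
  · rw [gaussianProfile_of_mem hx]
    exact stdNormalPDF_le_of_abs_le (by simp)
  · rw [gaussianProfile_of_notMem hx]
    exact (stdNormalPDF_pos _).le

theorem gaussianProfile_one_sub {x : ℝ} (hx : x ∈ Ioo (0 : ℝ) 1) :
    gaussianProfile (1 - x) = gaussianProfile x := by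
  have h : 1 - x ∈ Ioo (0 : ℝ) 1 := ⟨by linarith [hx.2], by linarith [hx.1]⟩
  rw [gaussianProfile_of_mem h, gaussianProfile_of_mem hx, stdNormalQuantile_one_sub hx,
    stdNormalPDF_neg]

theorem continuousAt_stdNormalQuantile {x : ℝ} (hx : x ∈ Ioo (0 : ℝ) 1) :
    ContinuousAt stdNormalQuantile x := by
  refine strictMonoOn_stdNormalQuantile.continuousAt_of_image_mem_nhds (isOpen_Ioo.mem_nhds hx) ?_
  refine mem_of_superset univ_mem fun t _ => ⟨stdNormalCDF t, stdNormalCDF_mem_Ioo t, ?_⟩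
  exact stdNormalQuantile_cdf t

theorem hasDerivAt_stdNormalQuantile {x : ℝ} (hx : x ∈ Ioo (0 : ℝ) 1) :
    HasDerivAt stdNormalQuantile (gaussianProfile x)⁻¹ x := by
  rw [gaussianProfile_of_mem hx]
  refine HasDerivAt.of_local_left_inverse (continuousAt_stdNormalQuantile hx)
    (hasDerivAt_stdNormalCDF _) (stdNormalPDF_pos _).ne' ?_
  filter_upwards [isOpen_Ioo.mem_nhds hx] with y hy using stdNormalCDF_quantile hy

theorem hasDerivAt_gaussianProfile {x : ℝ} (hx : x ∈ Ioo (0 : ℝ) 1) :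
    HasDerivAt gaussianProfile (-stdNormalQuantile x) x := by
  have h := (hasDerivAt_stdNormalPDF _).comp x (hasDerivAt_stdNormalQuantile hx)
  rw [← gaussianProfile_of_mem hx, mul_assoc, mul_inv_cancel₀ (gaussianProfile_pos hx).ne',
    mul_one] at h
  refine h.congr_of_eventuallyEq ?_
  filter_upwards [isOpen_Ioo.mem_nhds hx] with y hy using gaussianProfile_of_mem hy

theorem continuous_gaussianProfile : Continuous gaussianProfile := by
  refine continuous_iff_continuousAt.2 fun x => ?_
  by_cases hx : x ∈ Ioo (0 : ℝ) 1
  · exact (hasDerivAt_gaussianProfile hx).continuousAt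
  rw [ContinuousAt, gaussianProfile_of_notMem hx, Metric.tendsto_nhds]
  intro ε hε
  obtain ⟨T, hT, hT0⟩ := ((tendsto_stdNormalPDF_atTop.eventually (gt_mem_nhds hε)).and
    (eventually_ge_atTop 0)).exists
  -- Beyond `Φ(±T)` the quantile exceeds `T` in absolute value, so the profile is below `ε`. This
  -- covers the endpoints `0`, `1` and all exterior points at once.
  have key : ∀ y, (y < stdNormalCDF (-T) ∨ stdNormalCDF T < y) →
      dist (gaussianProfile y) 0 < ε := by
    intro y h
    rw [dist_zero_right, Real.norm_of_nonneg (gaussianProfile_nonneg y)]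
    by_cases hy : y ∈ Ioo (0 : ℝ) 1
    · rw [gaussianProfile_of_mem hy]
      refine (stdNormalPDF_le_of_abs_le ?_).trans_lt hT
      rw [abs_of_nonneg hT0, le_abs']
      rw [← stdNormalCDF_quantile hy, strictMono_stdNormalCDF.lt_iff_lt,
        strictMono_stdNormalCDF.lt_iff_lt] at h
      exact h.imp le_of_lt le_of_lt
    · rwa [gaussianProfile_of_notMem hy]
  rw [mem_Ioo, not_and_or, not_lt, not_lt] at hx
  rcases hx with hx | hx
  · filter_upwards [gt_mem_nhds (hx.trans_lt (stdNormalCDF_mem_Ioo (-T)).1)] with y hy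
      using key y (.inl hy)
  · filter_upwards [lt_mem_nhds ((stdNormalCDF_mem_Ioo T).2.trans_le hx)] with y hy
      using key y (.inr hy)

/-! ### The two-point inequality -/

theorem nonneg_of_hasDerivAt_nonneg {g g' : ℝ → ℝ} {X : ℝ}
    (hg : ∀ x ∈ Icc 0 X, HasDerivAt g (g' x) x) (h0 : g 0 = 0) (h' : ∀ x ∈ Icc 0 X, 0 ≤ g' x) :
    ∀ x ∈ Icc 0 X, 0 ≤ g x := by
  intro x hx
  have hm : MonotoneOn g (Icc 0 X) := by
    refine monotoneOn_of_deriv_nonneg (convex_Icc 0 X)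
      (fun y hy => (hg y hy).continuousAt.continuousWithinAt)
      (fun y hy => (hg y (interior_subset hy)).differentiableAt.differentiableWithinAt)
      fun y hy => ?_
    rw [(hg y (interior_subset hy)).deriv]
    exact h' y (interior_subset hy)
  exact h0 ▸ hm ⟨le_rfl, hx.1.trans hx.2⟩ hx hx.1

theorem nonneg_of_hasDerivAt_two_nonneg {g g' g'' : ℝ → ℝ} {X : ℝ}
    (hg : ∀ x ∈ Icc 0 X, HasDerivAt g (g' x) x) (hg' : ∀ x ∈ Icc 0 X, HasDerivAt g' (g'' x) x)
    (h0 : g 0 = 0) (h0' : g' 0 = 0) (h'' : ∀ x ∈ Icc 0 X, 0 ≤ g'' x) :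
    ∀ x ∈ Icc 0 X, 0 ≤ g x :=
  nonneg_of_hasDerivAt_nonneg hg h0 (nonneg_of_hasDerivAt_nonneg hg' h0' h'')

theorem HasDerivAt.comp_const_sub' {F : ℝ → ℝ} {F' c x : ℝ} (h : HasDerivAt F F' (c - x)) :
    HasDerivAt (fun y => F (c - y)) (-F') x := by
  exact (HasDerivAt.comp x h ((hasDerivAt_id x).const_sub c)).congr_deriv (by simp)

theorem HasDerivAt.comp_const_add' {F : ℝ → ℝ} {F' c x : ℝ} (h : HasDerivAt F F' (c + x)) :
    HasDerivAt (fun y => F (c + y)) F' x := by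
  exact (HasDerivAt.comp x h ((hasDerivAt_id x).const_add c)).congr_deriv (by simp)

theorem hasDerivAt_stdNormalQuantile_sq {x : ℝ} (hx : x ∈ Ioo (0 : ℝ) 1) :
    HasDerivAt (fun y => stdNormalQuantile y ^ 2)
      (2 * stdNormalQuantile x * (gaussianProfile x)⁻¹) x := by
  exact ((hasDerivAt_stdNormalQuantile hx).pow 2).congr_deriv (by simp)

theorem hasDerivAt_two_mul_stdNormalQuantile_mul_inv {x : ℝ} (hx : x ∈ Ioo (0 : ℝ) 1) :
    HasDerivAt (fun y => 2 * stdNormalQuantile y * (gaussianProfile y)⁻¹)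
      (2 * (1 + stdNormalQuantile x ^ 2) * (gaussianProfile x)⁻¹ ^ 2) x := by
  have hp := (gaussianProfile_pos hx).ne'
  refine (((hasDerivAt_stdNormalQuantile hx).const_mul 2).mul
    ((hasDerivAt_gaussianProfile hx).inv hp)).congr_deriv ?_
  rw [Pi.inv_apply]
  field_simp

theorem hasDerivAt_gaussianProfile_sq {x : ℝ} (hx : x ∈ Ioo (0 : ℝ) 1) :
    HasDerivAt (fun y => gaussianProfile y ^ 2)
      (-2 * (gaussianProfile x * stdNormalQuantile x)) x := by
  refine ((hasDerivAt_gaussianProfile hx).pow 2).congr_deriv ?_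
  simp; ring

theorem hasDerivAt_gaussianProfile_mul_quantile {x : ℝ} (hx : x ∈ Ioo (0 : ℝ) 1) :
    HasDerivAt (fun y => -2 * (gaussianProfile y * stdNormalQuantile y))
      (2 * stdNormalQuantile x ^ 2 - 2) x := by
  have hp := (gaussianProfile_pos hx).ne'
  refine (((hasDerivAt_gaussianProfile hx).mul
    (hasDerivAt_stdNormalQuantile hx)).const_mul (-2)).congr_deriv ?_
  rw [mul_inv_cancel₀ hp]; ring

section Midpoint

variable {c X : ℝ}

/-- Convexity of `q²`, since `(q²)'' = 2(1 + q²)/I²`. -/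
theorem two_mul_stdNormalQuantile_sq_le (h0 : 0 < c - X) (h1 : c + X < 1) :
    ∀ x ∈ Icc 0 X, 2 * stdNormalQuantile c ^ 2 ≤
      stdNormalQuantile (c + x) ^ 2 + stdNormalQuantile (c - x) ^ 2 := by
  have hp : ∀ x ∈ Icc 0 X, c + x ∈ Ioo (0 : ℝ) 1 :=
    fun x hx => ⟨by linarith [hx.1, hx.2], by linarith [hx.2]⟩
  have hm : ∀ x ∈ Icc 0 X, c - x ∈ Ioo (0 : ℝ) 1 :=
    fun x hx => ⟨by linarith [hx.2], by linarith [hx.1, hx.2]⟩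
  intro x hx
  rw [← sub_nonneg]
  refine nonneg_of_hasDerivAt_two_nonneg (X := X)
    (fun x hx => (((hasDerivAt_stdNormalQuantile_sq (hp x hx)).comp_const_add').add
      ((hasDerivAt_stdNormalQuantile_sq (hm x hx)).comp_const_sub')).sub_const _)
    (fun x hx => ((hasDerivAt_two_mul_stdNormalQuantile_mul_inv (hp x hx)).comp_const_add').add
      ((hasDerivAt_two_mul_stdNormalQuantile_mul_inv (hm x hx)).comp_const_sub').neg)
    ?_ ?_ ?_ x hx
  · simp; ring
  · simp
  · intro x hx
    rw [neg_neg]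
    positivity

/-- Because `(I²)'' = 2q² - 2`, the second derivative in `X` of right side minus left side is twice
the convexity defect of `q²` at `c`; value and slope vanish at `0`. -/
theorem two_mul_quantile_sq_mul_sq_le (h0 : 0 < c - X) (h1 : c + X < 1) (hX : 0 ≤ X) :
    2 * stdNormalQuantile c ^ 2 * X ^ 2 ≤
      gaussianProfile (c + X) ^ 2 + gaussianProfile (c - X) ^ 2 + 2 * X ^ 2
        - 2 * gaussianProfile c ^ 2 := by
  have hp : ∀ x ∈ Icc 0 X, c + x ∈ Ioo (0 : ℝ) 1 :=
    fun x hx => ⟨by linarith [hx.1, hx.2], by linarith [hx.2]⟩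
  have hm : ∀ x ∈ Icc 0 X, c - x ∈ Ioo (0 : ℝ) 1 :=
    fun x hx => ⟨by linarith [hx.2], by linarith [hx.1, hx.2]⟩
  set k := 2 - 2 * stdNormalQuantile c ^ 2
  have key := nonneg_of_hasDerivAt_two_nonneg (X := X)
    (fun x hx => ((((hasDerivAt_gaussianProfile_sq (hp x hx)).comp_const_add').add
      ((hasDerivAt_gaussianProfile_sq (hm x hx)).comp_const_sub')).add
      ((hasDerivAt_pow 2 x).const_mul k)).sub_const (2 * gaussianProfile c ^ 2))
    (fun x hx => (((hasDerivAt_gaussianProfile_mul_quantile (hp x hx)).comp_const_add').add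
      ((hasDerivAt_gaussianProfile_mul_quantile (hm x hx)).comp_const_sub').neg).add
      (((hasDerivAt_pow 1 x).const_mul (2 : ℝ)).const_mul k))
    (by simp; ring) (by simp) ?_ X ⟨hX, le_rfl⟩
  · simp only [Pi.add_apply] at key
    linarith
  · intro x hx
    have := two_mul_stdNormalQuantile_sq_le h0 h1 x hx
    simp only [k]
    norm_num
    linarith

/-- For `c ≤ 1/2` the point `c + x` lies between `c - x` and its reflection `1 - (c - x)`, and `q`
is increasing and odd about `1/2`. -/
theorem abs_quantile_add_le (h0 : 0 < c - X) (h1 : c + X < 1) (hc : c ≤ 1 / 2) :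
    ∀ x ∈ Icc 0 X, |stdNormalQuantile (c + x)| ≤ |stdNormalQuantile (c - x)| := by
  intro x hx
  have hp : c + x ∈ Ioo (0 : ℝ) 1 := ⟨by linarith [hx.1, hx.2], by linarith [hx.2]⟩
  have hm : c - x ∈ Ioo (0 : ℝ) 1 := ⟨by linarith [hx.2], by linarith [hx.1, hx.2]⟩
  have hm' : 1 - (c - x) ∈ Ioo (0 : ℝ) 1 := ⟨by linarith [hm.2], by linarith [hm.1]⟩
  have a := strictMonoOn_stdNormalQuantile.monotoneOn hm hp (by linarith [hx.1])
  have b := strictMonoOn_stdNormalQuantile.monotoneOn hp hm' (by linarith)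
  rw [stdNormalQuantile_one_sub hm] at b
  rw [abs_of_nonpos (by linarith : stdNormalQuantile (c - x) ≤ 0), abs_le]
  exact ⟨by linarith, b⟩

/-- The right side is the tangent at `X = 0` of the left side, whose second derivative `2(q(c+X)² -
q(c-X)²)` is nonpositive. -/
theorem profile_sq_sub_le (h0 : 0 < c - X) (h1 : c + X < 1) (hX : 0 ≤ X) (hc : c ≤ 1 / 2) :
    gaussianProfile (c + X) ^ 2 - gaussianProfile (c - X) ^ 2 ≤
      -4 * gaussianProfile c * stdNormalQuantile c * X := by
  have hp : ∀ x ∈ Icc 0 X, c + x ∈ Ioo (0 : ℝ) 1 :=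
    fun x hx => ⟨by linarith [hx.1, hx.2], by linarith [hx.2]⟩
  have hm : ∀ x ∈ Icc 0 X, c - x ∈ Ioo (0 : ℝ) 1 :=
    fun x hx => ⟨by linarith [hx.2], by linarith [hx.1, hx.2]⟩
  set k := -4 * gaussianProfile c * stdNormalQuantile c with hk
  have key := nonneg_of_hasDerivAt_two_nonneg (X := X)
    (fun x hx => (((hasDerivAt_id x).const_mul k).sub
      ((hasDerivAt_gaussianProfile_sq (hp x hx)).comp_const_add')).add
      ((hasDerivAt_gaussianProfile_sq (hm x hx)).comp_const_sub'))
    (fun x hx => ((hasDerivAt_const x (k * 1)).sub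
      ((hasDerivAt_gaussianProfile_mul_quantile (hp x hx)).comp_const_add')).add
      ((hasDerivAt_gaussianProfile_mul_quantile (hm x hx)).comp_const_sub').neg)
    (by simp) (by simp [hk]; ring) ?_ X ⟨hX, le_rfl⟩
  · simp only [Pi.add_apply, Pi.sub_apply, id] at key
    linarith
  · intro x hx
    have := sq_le_sq.2 (abs_quantile_add_le h0 h1 hc x hx)
    linarith

theorem profile_sub_le_profile_add (h0 : 0 < c - X) (h1 : c + X < 1) (hX : 0 ≤ X)
    (hc : c ≤ 1 / 2) : gaussianProfile (c - X) ≤ gaussianProfile (c + X) := by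
  rw [gaussianProfile_of_mem ⟨by linarith, by linarith⟩,
    gaussianProfile_of_mem ⟨by linarith, by linarith⟩]
  exact stdNormalPDF_le_of_abs_le (abs_quantile_add_le h0 h1 hc X ⟨hX, le_rfl⟩)

end Midpoint

/-- Removes the square roots. If `r + s < 2C`, both `(r+s)²` and `(r-s)²` are below `4C²`; expanding
`(4C² - (r+s)²)(4C² - (r-s)²) > 0` contradicts `h`. -/
theorem two_mul_le_add_of_sq_sub_sq_le {r s C : ℝ} (hr : 0 ≤ r) (hs : 0 ≤ s)
    (h : (r ^ 2 - s ^ 2) ^ 2 ≤ 8 * C ^ 2 * (r ^ 2 + s ^ 2 - 2 * C ^ 2)) : 2 * C ≤ r + s := by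
  by_contra! hlt
  have hp : (r + s) ^ 2 < 4 * C ^ 2 := by nlinarith
  have hd : (r - s) ^ 2 < 4 * C ^ 2 := by nlinarith [mul_nonneg hr hs]
  nlinarith [mul_pos (sub_pos.2 hp) (sub_pos.2 hd)]

theorem two_mul_gaussianProfile_midpoint_le {c X : ℝ} (h0 : 0 < c - X) (h1 : c + X < 1)
    (hX : 0 ≤ X) (hc : c ≤ 1 / 2) :
    2 * gaussianProfile c ≤ √(gaussianProfile (c + X) ^ 2 + X ^ 2) +
      √(gaussianProfile (c - X) ^ 2 + X ^ 2) := by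
  refine two_mul_le_add_of_sq_sub_sq_le (Real.sqrt_nonneg _) (Real.sqrt_nonneg _) ?_
  rw [Real.sq_sqrt (by positivity), Real.sq_sqrt (by positivity)]
  have hs := two_mul_quantile_sq_mul_sq_le h0 h1 hX
  have hw := profile_sq_sub_le h0 h1 hX hc
  -- The sign is needed to square `hw`. Then `16 I(c)² q(c)² X²` separates the two sides of the
  -- goal, the upper half coming from `hs`.
  have hw0 : 0 ≤ gaussianProfile (c + X) ^ 2 - gaussianProfile (c - X) ^ 2 := by
    have := profile_sub_le_profile_add h0 h1 hX hc
    have := gaussianProfile_nonneg (c - X)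
    rw [sub_nonneg]
    gcongr
  have h2 := pow_le_pow_left₀ hw0 hw 2
  have h3 := mul_le_mul_of_nonneg_left hs (by positivity : 0 ≤ 8 * gaussianProfile c ^ 2)
  nlinarith

theorem two_mul_gaussianProfile_le_of_mem_Ioo {a b : ℝ} (ha : a ∈ Ioo (0 : ℝ) 1)
    (hb : b ∈ Ioo (0 : ℝ) 1) :
    2 * gaussianProfile ((a + b) / 2) ≤ √(gaussianProfile a ^ 2 + ((a - b) / 2) ^ 2) +
      √(gaussianProfile b ^ 2 + ((a - b) / 2) ^ 2) := by
  wlog hab : b ≤ a generalizing a b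
  · have := this hb ha (le_of_not_ge hab)
    rw [add_comm b a, add_comm (√_)] at this
    rwa [show ((a - b) / 2) ^ 2 = ((b - a) / 2) ^ 2 by ring]
  -- The reflection `x ↦ 1 - x` preserves `I`; swapping the two points keeps them ordered.
  wlog hc : (a + b) / 2 ≤ 1 / 2 generalizing a b
  · have ha' : 1 - a ∈ Ioo (0 : ℝ) 1 := ⟨by linarith [ha.2], by linarith [ha.1]⟩
    have hb' : 1 - b ∈ Ioo (0 : ℝ) 1 := ⟨by linarith [hb.2], by linarith [hb.1]⟩
    have := this hb' ha' (by linarith) (by linarith)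
    rw [gaussianProfile_one_sub ha, gaussianProfile_one_sub hb, add_comm (√_),
      show (1 - b + (1 - a)) / 2 = 1 - (a + b) / 2 by ring,
      gaussianProfile_one_sub ⟨by linarith [ha.1, hb.1], by linarith [ha.2, hb.2]⟩] at this
    convert this using 5 <;> ring
  have ea : (a + b) / 2 + (a - b) / 2 = a := by ring
  have eb : (a + b) / 2 - (a - b) / 2 = b := by ring
  have := two_mul_gaussianProfile_midpoint_le (c := (a + b) / 2) (X := (a - b) / 2)
    (by linarith [hb.1]) (by linarith [ha.2]) (by linarith) hc
  rwa [ea, eb] at this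

/-- Bobkov's two-point inequality. -/
theorem two_mul_gaussianProfile_le {a b : ℝ} (ha : a ∈ Icc (0 : ℝ) 1) (hb : b ∈ Icc (0 : ℝ) 1) :
    2 * gaussianProfile ((a + b) / 2) ≤ √(gaussianProfile a ^ 2 + ((a - b) / 2) ^ 2) +
      √(gaussianProfile b ^ 2 + ((a - b) / 2) ^ 2) := by
  have hI := continuous_gaussianProfile
  have hcl : IsClosed {p : ℝ × ℝ | 2 * gaussianProfile ((p.1 + p.2) / 2) ≤
      √(gaussianProfile p.1 ^ 2 + ((p.1 - p.2) / 2) ^ 2) +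
      √(gaussianProfile p.2 ^ 2 + ((p.1 - p.2) / 2) ^ 2)} :=
    isClosed_le (by fun_prop) (by fun_prop)
  have hsub : Ioo (0 : ℝ) 1 ×ˢ Ioo (0 : ℝ) 1 ⊆ _ := fun p hp =>
    two_mul_gaussianProfile_le_of_mem_Ioo hp.1 hp.2
  have := hcl.closure_subset_iff.2 hsub
  rw [closure_prod_eq, closure_Ioo zero_ne_one] at this
  exact this (mk_mem_prod ha hb)

/-! ### Minkowski's inequality for lists -/

theorem sqrt_add_sq_add_sq_le (a b c d : ℝ) :
    √((a + b) ^ 2 + (c + d) ^ 2) ≤ √(a ^ 2 + c ^ 2) + √(b ^ 2 + d ^ 2) := by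
  refine Real.sqrt_le_iff.2 ⟨by positivity, ?_⟩
  have h : a * b + c * d ≤ √(a ^ 2 + c ^ 2) * √(b ^ 2 + d ^ 2) := by
    rw [← Real.sqrt_mul (by positivity)]
    refine Real.le_sqrt_of_sq_le ?_
    nlinarith [sq_nonneg (a * d - b * c)]
  rw [add_sq (√(a ^ 2 + c ^ 2)), Real.sq_sqrt (by positivity), Real.sq_sqrt (by positivity)]
  linarith

theorem List.sum_map_sq_nonneg {α : Type*} (l : List α) (h : α → ℝ) :
    0 ≤ (l.map fun w => h w ^ 2).sum :=
  List.sum_nonneg (by simpa using fun a _ => sq_nonneg (h a))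

theorem sqrt_sum_map_add_sq_le {α : Type*} (l : List α) (h k : α → ℝ) :
    √(l.map fun w => (h w + k w) ^ 2).sum ≤
      √(l.map fun w => h w ^ 2).sum + √(l.map fun w => k w ^ 2).sum := by
  induction l with
  | nil => simp
  | cons v l ih =>
    have h1 := l.sum_map_sq_nonneg h
    have h2 := l.sum_map_sq_nonneg k
    have h3 := l.sum_map_sq_nonneg fun w => h w + k w
    simp only [List.map_cons, List.sum_cons]
    have := sqrt_add_sq_add_sq_le (h v) (k v) (√(l.map fun w => h w ^ 2).sum)
      (√(l.map fun w => k w ^ 2).sum)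
    rw [Real.sq_sqrt h1, Real.sq_sqrt h2] at this
    refine le_trans (Real.sqrt_le_sqrt ?_) this
    rw [← Real.sq_sqrt h3]
    gcongr

theorem sqrt_sum_map_half_sq {α : Type*} (l : List α) (h : α → ℝ) :
    √(l.map fun w => (h w / 2) ^ 2).sum = √(l.map fun w => h w ^ 2).sum / 2 := by
  simp only [div_pow, div_eq_mul_inv _ ((2 : ℝ) ^ 2), List.sum_map_mul_right]
  rw [← div_eq_mul_inv, Real.sqrt_div (l.sum_map_sq_nonneg h), Real.sqrt_sq zero_le_two]

/-! ### Tensorisation along the sign walk -/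

section Walk

variable {E : Type*} [AddCommGroup E]

/-- The average of `F` over the two points `x ± v`. -/
noncomputable def signAverage (v : E) (F : E → ℝ) (x : E) : ℝ := (F (x + v) + F (x - v)) / 2

/-- The average of `F` over the points `x ± v₁ ± ⋯ ± vₖ`. -/
noncomputable def walkAverage : List E → (E → ℝ) → E → ℝ
  | [], F => F
  | v :: l, F => walkAverage l (signAverage v F)

theorem walkAverage_mono (l : List E) {F G : E → ℝ} (h : ∀ x, F x ≤ G x) (x : E) :
    walkAverage l F x ≤ walkAverage l G x := by
  induction l generalizing F G with
  | nil => exact h x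
  | cons v l ih =>
    refine ih fun y => ?_
    have := h (y + v)
    have := h (y - v)
    simp only [signAverage]
    linarith

theorem walkAverage_add_const (l : List E) (F : E → ℝ) (c : ℝ) (x : E) :
    walkAverage l (fun y => F y + c) x = walkAverage l F x + c := by
  induction l generalizing F with
  | nil => rfl
  | cons v l ih =>
    simp only [walkAverage]
    rw [← ih]
    congr 1
    funext y
    simp only [signAverage]
    ring

theorem signAverage_mem_Icc {f : E → ℝ} (hf : ∀ x, f x ∈ Icc (0 : ℝ) 1) (v x : E) :
    signAverage v f x ∈ Icc (0 : ℝ) 1 := by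
  have h1 := hf (x + v)
  have h2 := hf (x - v)
  simp only [signAverage]
  exact ⟨by linarith [h1.1, h2.1], by linarith [h1.2, h2.2]⟩

/-- Averaging preserves majorants of increments. This is why the induction carries a majorant `h`
and not the increments themselves. -/
theorem abs_signAverage_sub_le {f h : E → ℝ} {u : E} (hh : ∀ x, |f (x + u) - f x| / 2 ≤ h x)
    (v x : E) : |signAverage v f (x + u) - signAverage v f x| / 2 ≤ signAverage v h x := by
  have h1 := hh (x + v)
  have h2 := hh (x - v)
  have := abs_add_le (f (x + v + u) - f (x + v)) (f (x - v + u) - f (x - v))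
  simp only [signAverage]
  rw [add_right_comm x u v, ← sub_add_eq_add_sub x v u, ← sub_div, abs_div, abs_two,
    add_sub_add_comm]
  linarith

/-- The induction step: the two-point inequality absorbs direction `v` into `α`, Minkowski bounds
the other directions by `S`, and the triangle inequality in the plane joins the two. -/
theorem sqrt_signAverage_le {f : E → ℝ} (hf : ∀ x, f x ∈ Icc (0 : ℝ) 1) (h : E → E → ℝ)
    (l : List E)
    (v : E) (hp : ∀ x, |f (x + 2 • v) - f x| / 2 ≤ h v x)
    (hm : ∀ x, |f (x + -(2 • v)) - f x| / 2 ≤ h v x) (x : E) :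
    √(gaussianProfile (signAverage v f x) ^ 2 +
        (l.map fun w => signAverage v (h w) x ^ 2).sum) ≤
      signAverage v (fun y => √(gaussianProfile (f y) ^ 2 +
        ((v :: l).map fun w => h w y ^ 2).sum)) x := by
  have hsum (y : E) := l.sum_map_sq_nonneg fun w => h w y
  set S : E → ℝ := fun y => √(l.map fun w => h w y ^ 2).sum with hS
  set α : E → ℝ := fun y => √(gaussianProfile (f y) ^ 2 + h v y ^ 2) with hα
  have e (y : E) : √(gaussianProfile (f y) ^ 2 + ((v :: l).map fun w => h w y ^ 2).sum) =
      √(α y ^ 2 + S y ^ 2) := by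
    rw [hα, hS, Real.sq_sqrt (by positivity), Real.sq_sqrt (hsum y), List.map_cons, List.sum_cons,
      add_assoc]
  -- The neighbours `x ± v` differ by `2v`, so `hp` is used at `x - v` and `hm` at `x + v`.
  have h1 : |(f (x + v) - f (x - v)) / 2| ≤ h v (x - v) := by
    have := hp (x - v)
    rw [abs_div, abs_two]
    rwa [show x - v + 2 • v = x + v by rw [two_nsmul]; abel] at this
  have h2 : |(f (x + v) - f (x - v)) / 2| ≤ h v (x + v) := by
    have := hm (x + v)
    rw [abs_div, abs_two, abs_sub_comm]
    rwa [show x + v + -(2 • v) = x - v by rw [two_nsmul]; abel] at this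
  have hI : 2 * gaussianProfile (signAverage v f x) ≤ α (x + v) + α (x - v) := by
    refine (two_mul_gaussianProfile_le (hf (x + v)) (hf (x - v))).trans ?_
    simp only [hα]
    rw [← sq_abs ((f (x + v) - f (x - v)) / 2)]
    gcongr
  have hT : √(l.map fun w => signAverage v (h w) x ^ 2).sum ≤ (S (x + v) + S (x - v)) / 2 := by
    have := sqrt_sum_map_add_sq_le l (fun w => h w (x + v) / 2) fun w => h w (x - v) / 2
    rw [sqrt_sum_map_half_sq, sqrt_sum_map_half_sq, ← add_div] at this
    simpa only [signAverage, add_div] using this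
  have := sqrt_add_sq_add_sq_le (α (x + v) / 2) (α (x - v) / 2) (S (x + v) / 2) (S (x - v) / 2)
  simp only [div_pow, ← add_div] at this
  rw [Real.sqrt_div (by positivity : 0 ≤ α (x + v) ^ 2 + S (x + v) ^ 2),
    Real.sqrt_div (by positivity : 0 ≤ α (x - v) ^ 2 + S (x - v) ^ 2),
    Real.sqrt_sq zero_le_two, ← add_div] at this
  simp only [e]
  rw [signAverage.eq_1 v fun y => √(α y ^ 2 + S y ^ 2)]
  refine le_trans (Real.sqrt_le_sqrt ?_) this
  have hI0 := gaussianProfile_nonneg (signAverage v f x)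
  have hsum' := l.sum_map_sq_nonneg fun w => signAverage v (h w) x
  rw [← Real.sq_sqrt hsum', add_div, ← div_pow, ← div_pow]
  gcongr
  linarith

/-- The functional isoperimetric inequality on the discrete cube, for the walk `x ± v₁ ± ⋯ ± vₖ`. -/
theorem gaussianProfile_walkAverage_le (l : List E) {f : E → ℝ} (hf : ∀ x, f x ∈ Icc (0 : ℝ) 1)
    (h : E → E → ℝ) (hp : ∀ v ∈ l, ∀ x, |f (x + 2 • v) - f x| / 2 ≤ h v x)
    (hm : ∀ v ∈ l, ∀ x, |f (x + -(2 • v)) - f x| / 2 ≤ h v x) (x : E) :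
    gaussianProfile (walkAverage l f x) ≤
      walkAverage l (fun y => √(gaussianProfile (f y) ^ 2 + (l.map fun w => h w y ^ 2).sum)) x := by
  induction l generalizing f h with
  | nil => simp [walkAverage, Real.sqrt_sq (gaussianProfile_nonneg _)]
  | cons v l ih =>
    refine (ih (signAverage_mem_Icc hf v) (fun w => signAverage v (h w))
      (fun w hw => abs_signAverage_sub_le (hp w (.tail _ hw)) v)
      (fun w hw => abs_signAverage_sub_le (hm w (.tail _ hw)) v)).trans ?_
    exact walkAverage_mono l
      (sqrt_signAverage_le hf h l v (hp v (.head _)) (hm v (.head _))) x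

end Walk

/-! ### The law of the walk and its Gaussian limit -/

section WalkLaw

variable {E : Type*} [NormedAddCommGroup E] [MeasurableSpace E]

/-- The uniform measure on the two points `±v`. -/
noncomputable def signMeasure (v : E) : Measure E :=
  (2⁻¹ : ENNReal) • Measure.dirac v + (2⁻¹ : ENNReal) • Measure.dirac (-v)

instance isProbabilityMeasure_signMeasure (v : E) : IsProbabilityMeasure (signMeasure v) :=
  ⟨by simp [signMeasure, ENNReal.inv_two_add_inv_two]⟩

/-- The law of `±v₁ ± ⋯ ± vₖ`. -/
noncomputable def walkLaw : List E → Measure E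
  | [] => Measure.dirac 0
  | v :: l => walkLaw l ∗ signMeasure v

variable [BorelSpace E] [SecondCountableTopology E]

instance isProbabilityMeasure_walkLaw (l : List E) : IsProbabilityMeasure (walkLaw l) := by
  induction l with
  | nil => unfold walkLaw; infer_instance
  | cons v l ih => unfold walkLaw; infer_instance

theorem integral_signMeasure {F : Type*} [NormedAddCommGroup F] [NormedSpace ℝ F] [CompleteSpace F]
    (v : E) (f : E → F) :
    ∫ x, f x ∂(signMeasure v) = (2⁻¹ : ℝ) • (f v + f (-v)) := by
  have h (w : E) : Integrable f ((2⁻¹ : ENNReal) • Measure.dirac w) :=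
    (integrable_dirac (by simp)).smul_measure (by simp)
  rw [signMeasure, integral_add_measure (h _) (h _), integral_smul_measure, integral_smul_measure,
    integral_dirac, integral_dirac, smul_add]
  simp

theorem integral_walkLaw (l : List E) {f : E → ℝ} (hf : Continuous f) {C : ℝ}
    (hC : ∀ x, |f x| ≤ C) : ∫ x, f x ∂(walkLaw l) = walkAverage l f 0 := by
  induction l generalizing f with
  | nil => simp [walkLaw, walkAverage]
  | cons v l ih =>
    have hi : Integrable f (walkLaw l ∗ signMeasure v) :=
      .of_bound hf.aestronglyMeasurable C (ae_of_all _ hC)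
    have e : (fun x => ∫ y, f (x + y) ∂(signMeasure v)) = signAverage v f := by
      funext x
      rw [integral_signMeasure, signAverage, smul_eq_mul, inv_mul_eq_div, sub_eq_add_neg x v]
    rw [walkLaw, integral_conv hi, e, walkAverage]
    refine ih (by unfold signAverage; fun_prop) fun x => ?_
    rw [signAverage, abs_div, abs_two]
    have := abs_add_le (f (x + v)) (f (x - v))
    linarith [hC (x + v), hC (x - v)]

end WalkLaw

section CharFun

variable {E : Type*} [NormedAddCommGroup E] [InnerProductSpace ℝ E] [MeasurableSpace E]
  [BorelSpace E] [SecondCountableTopology E]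

theorem charFun_signMeasure (v t : E) :
    charFun (signMeasure v) t = (Real.cos (inner ℝ v t) : ℂ) := by
  rw [charFun_apply, integral_signMeasure]
  simp only [inner_neg_left, Complex.ofReal_neg, neg_mul, Complex.ofReal_cos, Complex.cos]
  rw [Complex.real_smul]
  push_cast
  ring

theorem charFun_walkLaw (l : List E) (t : E) :
    charFun (walkLaw l) t = (l.map fun v => (Real.cos (inner ℝ v t) : ℂ)).prod := by
  induction l with
  | nil => simp [walkLaw]
  | cons v l ih =>
    rw [walkLaw, charFun_conv, ih, charFun_signMeasure, List.map_cons, List.prod_cons, mul_comm]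

end CharFun

/-- Since `1 - cos u = 2 sin²(u/2)`, one has `m(cos(t/√m) - 1) = -(t²/2) sinc²(t/(2√m))` for `m >
0`, which tends to `-t²/2`. -/
theorem tendsto_cos_div_sqrt_pow (t : ℝ) :
    Tendsto (fun m : ℕ => Real.cos (t / √m) ^ m) atTop (𝓝 (Real.exp (-t ^ 2 / 2))) := by
  have h0 : Tendsto (fun m : ℕ => t / √m / 2) atTop (𝓝 0) := by
    have := (tendsto_const_nhds (x := t)).div_atTop
      (Real.tendsto_sqrt_atTop.comp tendsto_natCast_atTop_atTop)
    simpa using this.div_const 2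
  have h1 : Tendsto (fun m : ℕ => -t ^ 2 / 2 * Real.sinc (t / √m / 2) ^ 2) atTop
      (𝓝 (-t ^ 2 / 2)) := by
    have := (Real.continuous_sinc.tendsto 0).comp h0
    rw [Real.sinc_zero] at this
    simpa using (this.pow 2).const_mul (-t ^ 2 / 2)
  have h2 : Tendsto (fun m : ℕ => (m : ℝ) * (Real.cos (t / √m) - 1)) atTop (𝓝 (-t ^ 2 / 2)) := by
    refine h1.congr' ?_
    filter_upwards [eventually_gt_atTop 0] with m hm
    have hm' : (0 : ℝ) < m := Nat.cast_pos.2 hm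
    have hc : Real.cos (t / √m) = 1 - 2 * Real.sin (t / √m / 2) ^ 2 := by
      rw [← Real.cos_two_mul_eq_one_sub]
      congr 1; ring
    rw [hc]
    rcases eq_or_ne t 0 with rfl | ht
    · simp
    rw [Real.sinc_of_ne_zero (by positivity)]
    have := Real.sq_sqrt hm'.le
    field_simp
    rw [this]
    ring
  refine (Real.tendsto_one_add_pow_exp_of_tendsto h2).congr fun m => ?_
  simp

section GridSteps

/-- The list of steps with every `eᵢ / √m` repeated `m` times. -/
noncomputable def gridSteps (n m : ℕ) : List (EuclideanSpace ℝ (Fin n)) :=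
  (List.finRange n).flatMap fun i => List.replicate m (EuclideanSpace.single i (√m)⁻¹)

theorem mem_gridSteps {n m : ℕ} {v : EuclideanSpace ℝ (Fin n)} (hv : v ∈ gridSteps n m) :
    ‖v‖ = (√m)⁻¹ := by
  simp only [gridSteps, List.mem_flatMap, List.mem_replicate] at hv
  obtain ⟨i, -, -, rfl⟩ := hv
  simp [abs_of_nonneg]

theorem prod_map_gridSteps {M : Type*} [CommMonoid M] (n m : ℕ) (g : EuclideanSpace ℝ (Fin n) → M) :
    ((gridSteps n m).map g).prod = ∏ i, g (EuclideanSpace.single i (√m)⁻¹) ^ m := by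
  rw [gridSteps, Fin.prod_univ_def]
  induction List.finRange n with
  | nil => simp
  | cons i l ih => simp [ih]

theorem sum_map_gridSteps (n m : ℕ) (g : EuclideanSpace ℝ (Fin n) → ℝ) :
    ((gridSteps n m).map g).sum = ∑ i, m * g (EuclideanSpace.single i (√m)⁻¹) := by
  rw [gridSteps, Fin.sum_univ_def]
  induction List.finRange n with
  | nil => simp
  | cons i l ih => simp [ih]

/-- The central limit theorem for the walk, by Lévy's continuity theorem: the characteristic
functions are products of `cos(tᵢ/√m)^m`. -/
theorem tendsto_walkAverage_gridSteps (n : ℕ) {f : EuclideanSpace ℝ (Fin n) → ℝ}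
    (hf : Continuous f) {C : ℝ} (hC : ∀ x, |f x| ≤ C) :
    Tendsto (fun m => walkAverage (gridSteps n m) f 0) atTop
      (𝓝 (∫ x, f x ∂(stdGaussian (EuclideanSpace ℝ (Fin n))))) := by
  let μ (m : ℕ) : ProbabilityMeasure (EuclideanSpace ℝ (Fin n)) :=
    ⟨walkLaw (gridSteps n m), inferInstance⟩
  let γ : ProbabilityMeasure (EuclideanSpace ℝ (Fin n)) :=
    ⟨stdGaussian (EuclideanSpace ℝ (Fin n)), inferInstance⟩
  have hμ : Tendsto μ atTop (𝓝 γ) := by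
    refine ProbabilityMeasure.tendsto_of_tendsto_charFun fun t => ?_
    have h1 : Tendsto (fun m : ℕ => ((∏ i, Real.cos (t i / √m) ^ m : ℝ) : ℂ)) atTop
        (𝓝 ((∏ i, Real.exp (-t i ^ 2 / 2) : ℝ) : ℂ)) :=
      (Complex.continuous_ofReal.tendsto _).comp
        (tendsto_finsetProd _ fun i _ => tendsto_cos_div_sqrt_pow (t i))
    have h2 : charFun (stdGaussian (EuclideanSpace ℝ (Fin n))) t =
        ((∏ i, Real.exp (-t i ^ 2 / 2) : ℝ) : ℂ) := by
      rw [charFun_stdGaussian, ← Real.exp_sum, ← Finset.sum_div, Finset.sum_neg_distrib,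
        ← EuclideanSpace.real_norm_sq_eq]
      push_cast
      rfl
    have h3 (m : ℕ) : charFun (walkLaw (gridSteps n m)) t =
        ((∏ i, Real.cos (t i / √m) ^ m : ℝ) : ℂ) := by
      rw [charFun_walkLaw, prod_map_gridSteps, Complex.ofReal_prod]
      refine Finset.prod_congr rfl fun i _ => ?_
      rw [Complex.ofReal_pow, EuclideanSpace.inner_single_left]
      simp [div_eq_inv_mul]
    change Tendsto (fun m => charFun (walkLaw (gridSteps n m)) t) atTop
      (𝓝 (charFun (stdGaussian (EuclideanSpace ℝ (Fin n))) t))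
    rw [h2]
    exact h1.congr fun m => (h3 m).symm
  have := (ProbabilityMeasure.tendsto_iff_forall_integral_tendsto.1 hμ)
    (BoundedContinuousFunction.ofNormedAddCommGroup f hf C hC)
  exact this.congr fun m => integral_walkLaw _ hf hC

end GridSteps

/-! ### The inequality for compactly supported functions -/

section CompactSupport

theorem norm_gradient {F : Type*} [NormedAddCommGroup F] [InnerProductSpace ℝ F] [CompleteSpace F]
    (f : F → ℝ) (x : F) : ‖∇ f x‖ = ‖fderiv ℝ f x‖ := by
  rw [← toDual_gradient, LinearIsometryEquiv.norm_map]

theorem norm_gradient_sq_eq_sum {n : ℕ} (f : EuclideanSpace ℝ (Fin n) → ℝ)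
    (x : EuclideanSpace ℝ (Fin n)) :
    ‖∇ f x‖ ^ 2 = ∑ i, fderiv ℝ f x (EuclideanSpace.single i 1) ^ 2 := by
  rw [EuclideanSpace.real_norm_sq_eq]
  refine Finset.sum_congr rfl fun i _ => ?_
  rw [← inner_gradient_left, EuclideanSpace.inner_single_right]
  simp

theorem continuous_sqrt_profile_sq_add {n : ℕ} {f : EuclideanSpace ℝ (Fin n) → ℝ}
    (hf : ContDiff ℝ 1 f) :
    Continuous fun x => √(gaussianProfile (f x) ^ 2 + ‖∇ f x‖ ^ 2) := by
  have h1 := continuous_gaussianProfile.comp hf.continuous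
  have h2 := hf.continuous_fderiv one_ne_zero
  simp only [norm_gradient]
  exact ((h1.pow 2).add (h2.norm.pow 2)).sqrt

theorem abs_sub_sub_fderiv_le {E : Type*} [NormedAddCommGroup E] [NormedSpace ℝ E] {f : E → ℝ}
    (hf : Differentiable ℝ f) {δ η : ℝ}
    (hη : ∀ x y, dist x y < η → dist (fderiv ℝ f x) (fderiv ℝ f y) < δ) (x : E) {u : E}
    (hu : ‖u‖ < η) : |f (x + u) - f x - fderiv ℝ f x u| ≤ δ * ‖u‖ := by
  have := (convex_ball x η).norm_image_sub_le_of_norm_hasFDerivWithin_le' (f := f)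
    (f' := fderiv ℝ f) (φ := fderiv ℝ f x) (C := δ) (y := x + u) (x := x)
    (fun y _ => (hf y).hasFDerivAt.hasFDerivWithinAt)
    (fun y hy => by
      rw [← dist_eq_norm]
      exact (hη y x hy).le)
    (Metric.mem_ball_self ((norm_nonneg u).trans_lt hu)) (by simpa using hu)
  simpa using this

theorem abs_sub_div_two_le {E : Type*} [NormedAddCommGroup E] [NormedSpace ℝ E] {f : E → ℝ}
    (hf : Differentiable ℝ f) {δ η : ℝ}
    (hη : ∀ x y, dist x y < η → dist (fderiv ℝ f x) (fderiv ℝ f y) < δ) (x : E) {u : E}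
    (hu : ‖(2 : ℝ) • u‖ < η) :
    |f (x + (2 : ℝ) • u) - f x| / 2 ≤ |fderiv ℝ f x u| + δ * ‖u‖ := by
  have h1 := abs_sub_sub_fderiv_le hf hη x hu
  have h2 := abs_sub_abs_le_abs_sub (f (x + (2 : ℝ) • u) - f x) (fderiv ℝ f x ((2 : ℝ) • u))
  rw [norm_smul, Real.norm_two] at h1
  have h3 : |fderiv ℝ f x ((2 : ℝ) • u)| = 2 * |fderiv ℝ f x u| := by
    rw [map_smul, smul_eq_mul, abs_mul, abs_two]
  linarith

/-- The `m` copies of `eᵢ/√m` contribute `(∂ᵢf)²` in total, giving `|∇f|²`. The `nm` errors `δ/√m`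
have Euclidean norm `δ√n`, uniformly in `m`. -/
theorem sqrt_profile_sq_add_sum_le {n m : ℕ} (hm : 0 < m) (f : EuclideanSpace ℝ (Fin n) → ℝ)
    {δ : ℝ} (hδ : 0 ≤ δ) (x : EuclideanSpace ℝ (Fin n)) :
    √(gaussianProfile (f x) ^ 2 +
        ((gridSteps n m).map fun v => (|fderiv ℝ f x v| + δ * ‖v‖) ^ 2).sum) ≤
      √(gaussianProfile (f x) ^ 2 + ‖∇ f x‖ ^ 2) + δ * √n := by
  have hm' : (0 : ℝ) < m := Nat.cast_pos.2 hm
  have hsq : (m : ℝ) * ((√m)⁻¹) ^ 2 = 1 := by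
    rw [inv_pow, Real.sq_sqrt hm'.le, mul_inv_cancel₀ hm'.ne']
  have h1 : ((gridSteps n m).map fun v => |fderiv ℝ f x v| ^ 2).sum = ‖∇ f x‖ ^ 2 := by
    rw [sum_map_gridSteps, norm_gradient_sq_eq_sum]
    refine Finset.sum_congr rfl fun i _ => ?_
    have : (EuclideanSpace.single i (√m)⁻¹ : EuclideanSpace ℝ (Fin n)) =
        (√m)⁻¹ • EuclideanSpace.single i (1 : ℝ) := by
      ext j
      simp
    rw [this, map_smul, sq_abs, smul_eq_mul, mul_pow, ← mul_assoc, hsq, one_mul]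
  have h2 : ((gridSteps n m).map fun v => (δ * ‖v‖) ^ 2).sum = (δ * √n) ^ 2 := by
    rw [sum_map_gridSteps, mul_pow, Real.sq_sqrt n.cast_nonneg]
    have (i : Fin n) : (m : ℝ) * (δ * ‖(EuclideanSpace.single i (√m)⁻¹ :
        EuclideanSpace ℝ (Fin n))‖) ^ 2 = δ ^ 2 := by
      rw [PiLp.norm_single, Real.norm_of_nonneg (by positivity), mul_pow, mul_left_comm, hsq,
        mul_one]
    simp only [this, Finset.sum_const, Finset.card_univ, Fintype.card_fin, nsmul_eq_mul]
    ring
  have h3 := sqrt_sum_map_add_sq_le (gridSteps n m) (fun v => |fderiv ℝ f x v|) fun v => δ * ‖v‖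
  rw [h1, h2, Real.sqrt_sq (norm_nonneg _), Real.sqrt_sq (by positivity)] at h3
  have h4 := sqrt_add_sq_add_sq_le (gaussianProfile (f x)) 0 ‖∇ f x‖ (δ * √n)
  rw [add_zero, zero_pow two_ne_zero, zero_add, Real.sqrt_sq (by positivity)] at h4
  refine le_trans (Real.sqrt_le_sqrt ?_) h4
  rw [← Real.sq_sqrt ((gridSteps n m).sum_map_sq_nonneg fun v => |fderiv ℝ f x v| + δ * ‖v‖)]
  gcongr

theorem gaussianProfile_integral_le_of_hasCompactSupport {n : ℕ}
    {f : EuclideanSpace ℝ (Fin n) → ℝ} (hf : ContDiff ℝ 1 f) (hf01 : ∀ x, f x ∈ Icc (0 : ℝ) 1)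
    (hs : HasCompactSupport f) :
    gaussianProfile (∫ x, f x ∂(stdGaussian (EuclideanSpace ℝ (Fin n)))) ≤
      ∫ x, √(gaussianProfile (f x) ^ 2 + ‖∇ f x‖ ^ 2)
        ∂(stdGaussian (EuclideanSpace ℝ (Fin n))) := by
  have hD := hf.continuous_fderiv one_ne_zero
  have hDs : HasCompactSupport (fderiv ℝ f) := hs.fderiv ℝ
  obtain ⟨C, hC⟩ := hDs.exists_bound_of_continuous hD
  have hbound : ∀ x, |√(gaussianProfile (f x) ^ 2 + ‖∇ f x‖ ^ 2)| ≤
      √(stdNormalPDF 0 ^ 2 + C ^ 2) := by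
    intro x
    rw [abs_of_nonneg (Real.sqrt_nonneg _), norm_gradient]
    have := gaussianProfile_nonneg (f x)
    have := gaussianProfile_le (f x)
    have := hC x
    gcongr
  have hlim := tendsto_walkAverage_gridSteps n (continuous_sqrt_profile_sq_add hf) hbound
  have hlim' := tendsto_walkAverage_gridSteps n hf.continuous (C := 1) fun x =>
    abs_le.2 ⟨by linarith [(hf01 x).1], (hf01 x).2⟩
  refine le_of_forall_pos_le_add fun ε hε => ?_
  -- The `+ 1` keeps the denominator positive for `n = 0` and still gives `δ√n ≤ ε`.
  set δ := ε / (√n + 1) with hδ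
  have hδ0 : 0 < δ := by positivity
  obtain ⟨η, hη0, hη⟩ := Metric.uniformContinuous_iff.1
    (hDs.uniformContinuous_of_continuous hD) δ hδ0
  have hstep : ∀ᶠ m : ℕ in atTop, 2 * (√m)⁻¹ < η := by
    have : Tendsto (fun m : ℕ => 2 * (√m)⁻¹) atTop (𝓝 (2 * 0)) :=
      (tendsto_inv_atTop_zero.comp
        (Real.tendsto_sqrt_atTop.comp tendsto_natCast_atTop_atTop)).const_mul 2
    rw [mul_zero] at this
    exact this.eventually (gt_mem_nhds hη0)
  have hmain : gaussianProfile (∫ x, f x ∂(stdGaussian (EuclideanSpace ℝ (Fin n)))) ≤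
      ∫ x, √(gaussianProfile (f x) ^ 2 + ‖∇ f x‖ ^ 2)
        ∂(stdGaussian (EuclideanSpace ℝ (Fin n))) + δ * √n := by
    refine le_of_tendsto_of_tendsto ((continuous_gaussianProfile.tendsto _).comp hlim')
      (hlim.add_const (δ * √n)) ?_
    filter_upwards [hstep, eventually_gt_atTop 0] with m hm hm0
    have hv : ∀ v ∈ gridSteps n m, ‖(2 : ℝ) • v‖ < η := by
      intro v hv
      rwa [norm_smul, Real.norm_two, mem_gridSteps hv]
    have hdiff := hf.differentiable one_ne_zero
    refine (gaussianProfile_walkAverage_le (gridSteps n m) hf01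
      (fun v x => |fderiv ℝ f x v| + δ * ‖v‖) (fun v h x => ?_) (fun v h x => ?_) 0).trans ?_
    · have := abs_sub_div_two_le hdiff (fun x y => hη (a := x) (b := y)) x (hv v h)
      rwa [two_smul, ← two_nsmul] at this
    · have := abs_sub_div_two_le hdiff (fun x y => hη (a := x) (b := y)) x (u := -v)
        (by rw [smul_neg, norm_neg]; exact hv v h)
      rwa [smul_neg, two_smul, ← two_nsmul, map_neg, abs_neg, norm_neg] at this
    · rw [← walkAverage_add_const]
      exact walkAverage_mono _ (sqrt_profile_sq_add_sum_le hm0 f hδ0.le) 0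
  refine hmain.trans ?_
  gcongr
  rw [hδ, div_mul_eq_mul_div, div_le_iff₀ (by positivity)]
  gcongr
  linarith

end CompactSupport

/-! ### Removing the compact support -/

section Truncation

/-- The function `f` cut off smoothly to a ball of radius of order `k`. -/
noncomputable def smoothTruncation {n : ℕ} (χ : ContDiffBump (0 : EuclideanSpace ℝ (Fin n)))
    (f : EuclideanSpace ℝ (Fin n) → ℝ) (k : ℕ) (x : EuclideanSpace ℝ (Fin n)) : ℝ :=
  χ (((k : ℝ) + 1)⁻¹ • x) * f x

variable {n : ℕ} (χ : ContDiffBump (0 : EuclideanSpace ℝ (Fin n)))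
  {f : EuclideanSpace ℝ (Fin n) → ℝ}

theorem contDiff_smoothTruncation (hf : ContDiff ℝ 1 f) (k : ℕ) : 
    ContDiff ℝ 1 (smoothTruncation χ f k) :=
  (χ.contDiff.comp (contDiff_id.const_smul _)).mul hf

theorem hasCompactSupport_smoothTruncation (k : ℕ) : HasCompactSupport (smoothTruncation χ f k) :=
  -- The scale `(k + 1)⁻¹` is nonzero even for `k = 0`.
  (χ.hasCompactSupport.comp_smul (by positivity)).mul_right

theorem smoothTruncation_mem_Icc (hf01 : ∀ x, f x ∈ Icc (0 : ℝ) 1) (k : ℕ)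
    (x : EuclideanSpace ℝ (Fin n)) : smoothTruncation χ f k x ∈ Icc (0 : ℝ) 1 :=
  ⟨mul_nonneg χ.nonneg (hf01 x).1, mul_le_one₀ χ.le_one (hf01 x).1 (hf01 x).2⟩

/-- Agreement on a neighbourhood, not only at `x`, makes the gradients agree as well. -/
theorem eventually_smoothTruncation_eventuallyEq (x : EuclideanSpace ℝ (Fin n)) :
    ∀ᶠ k in atTop, smoothTruncation χ f k =ᶠ[𝓝 x] f := by
  have h : Tendsto (fun k : ℕ => ‖((k : ℝ) + 1)⁻¹ • x‖) atTop (𝓝 0) := by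
    have := (tendsto_one_div_add_atTop_nhds_zero_nat (𝕜 := ℝ)).smul_const x
    simpa using this.norm
  filter_upwards [h.eventually (gt_mem_nhds χ.rIn_pos)] with k hk
  have hc : Continuous fun y : EuclideanSpace ℝ (Fin n) => ‖((k : ℝ) + 1)⁻¹ • y‖ := by fun_prop
  filter_upwards [hc.continuousAt.eventually (gt_mem_nhds hk)] with y hy
  rw [smoothTruncation, χ.one_of_mem_closedBall (by simpa using hy.le), one_mul]

theorem norm_fderiv_smoothTruncation_le (hf : ContDiff ℝ 1 f) (hf01 : ∀ x, f x ∈ Icc (0 : ℝ) 1)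
    {C : ℝ}
    (hC : ∀ x, ‖fderiv ℝ χ x‖ ≤ C) (k : ℕ) (x : EuclideanSpace ℝ (Fin n)) :
    ‖fderiv ℝ (smoothTruncation χ f k) x‖ ≤ ‖fderiv ℝ f x‖ + C := by
  set s : ℝ := ((k : ℝ) + 1)⁻¹ with hs
  have hs0 : 0 ≤ s := by positivity
  have hs1 : s ≤ 1 := inv_le_one_of_one_le₀ (by linarith [k.cast_nonneg (α := ℝ)])
  have hχ : Differentiable ℝ χ := (χ.contDiff (n := 1)).differentiable one_ne_zero
  have h1 : HasFDerivAt (fun y => χ (s • y)) (s • fderiv ℝ χ (s • x)) x := by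
    have := (hχ (s • x)).hasFDerivAt.comp x ((hasFDerivAt_id x).const_smul s)
    refine this.congr_fderiv ?_
    ext v
    simp
  have h2 := (h1.mul (hf.differentiable one_ne_zero x).hasFDerivAt).fderiv
  have e : smoothTruncation χ f k = (fun y => χ (s • y)) * f := rfl
  rw [e, h2]
  refine (norm_add_le _ _).trans (add_le_add ?_ ?_)
  · rw [norm_smul, Real.norm_of_nonneg χ.nonneg]
    exact mul_le_of_le_one_left (norm_nonneg _) χ.le_one
  · rw [norm_smul, norm_smul, Real.norm_of_nonneg (hf01 x).1, Real.norm_of_nonneg hs0]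
    have := hC (s • x)
    calc f x * (s * ‖fderiv ℝ χ (s • x)‖) ≤ 1 * (1 * C) := by
          gcongr
          exact (hf01 x).2
      _ = C := by ring

end Truncation

theorem gaussianProfile_integral_le_of_integrable {n : ℕ} {f : EuclideanSpace ℝ (Fin n) → ℝ}
    (hf : ContDiff ℝ 1 f) (hf01 : ∀ x, f x ∈ Icc (0 : ℝ) 1)
    (hi : Integrable (fun x => √(gaussianProfile (f x) ^ 2 + ‖∇ f x‖ ^ 2))
      (stdGaussian (EuclideanSpace ℝ (Fin n)))) :
    gaussianProfile (∫ x, f x ∂(stdGaussian (EuclideanSpace ℝ (Fin n)))) ≤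
      ∫ x, √(gaussianProfile (f x) ^ 2 + ‖∇ f x‖ ^ 2)
        ∂(stdGaussian (EuclideanSpace ℝ (Fin n))) := by
  let χ : ContDiffBump (0 : EuclideanSpace ℝ (Fin n)) := ⟨1, 2, one_pos, one_lt_two⟩
  obtain ⟨C, hC⟩ := (χ.hasCompactSupport.fderiv ℝ).exists_bound_of_continuous
    ((χ.contDiff (n := 1)).continuous_fderiv one_ne_zero)
  have hlim : Tendsto
      (fun k => ∫ x, smoothTruncation χ f k x ∂(stdGaussian (EuclideanSpace ℝ (Fin n))))
      atTop (𝓝 (∫ x, f x ∂(stdGaussian (EuclideanSpace ℝ (Fin n))))) := by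
    refine tendsto_integral_of_dominated_convergence (fun _ => 1)
      (fun k => (contDiff_smoothTruncation χ hf k).continuous.aestronglyMeasurable)
      (integrable_const 1) (fun k => ae_of_all _ fun x => ?_) (ae_of_all _ fun x => ?_)
    · have := smoothTruncation_mem_Icc χ hf01 k x
      rw [Real.norm_of_nonneg this.1]
      exact this.2
    · refine tendsto_const_nhds.congr' ?_
      filter_upwards [eventually_smoothTruncation_eventuallyEq χ (f := f) x] with k hk
        using hk.eq_of_nhds.symm
  have hlim' : Tendsto (fun k => ∫ x, √(gaussianProfile (smoothTruncation χ f k x) ^ 2 +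
      ‖∇ (smoothTruncation χ f k) x‖ ^ 2) ∂(stdGaussian (EuclideanSpace ℝ (Fin n)))) atTop
      (𝓝 (∫ x, √(gaussianProfile (f x) ^ 2 + ‖∇ f x‖ ^ 2)
        ∂(stdGaussian (EuclideanSpace ℝ (Fin n))))) := by
    refine tendsto_integral_of_dominated_convergence
      -- `C` bounds the gradient contributed by the cutoff and `φ(0)` is the maximum of `I`.
      (fun x => √(gaussianProfile (f x) ^ 2 + ‖∇ f x‖ ^ 2) + (C + stdNormalPDF 0))
      (fun k => (continuous_sqrt_profile_sq_add
        (contDiff_smoothTruncation χ hf k)).aestronglyMeasurable)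
      (hi.add (integrable_const _)) (fun k => ae_of_all _ fun x => ?_) (ae_of_all _ fun x => ?_)
    · rw [Real.norm_of_nonneg (Real.sqrt_nonneg _)]
      have h1 := norm_fderiv_smoothTruncation_le χ hf hf01 hC k x
      rw [← norm_gradient, ← norm_gradient] at h1
      have h2 : ‖∇ f x‖ ≤ √(gaussianProfile (f x) ^ 2 + ‖∇ f x‖ ^ 2) :=
        Real.le_sqrt_of_sq_le (le_add_of_nonneg_left (sq_nonneg _))
      have h3 := sqrt_add_sq_add_sq_le (gaussianProfile (smoothTruncation χ f k x)) 0 0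
        ‖∇ (smoothTruncation χ f k) x‖
      simp only [add_zero, zero_add, ne_eq, two_ne_zero, not_false_eq_true, zero_pow,
        Real.sqrt_sq (norm_nonneg _), Real.sqrt_sq (gaussianProfile_nonneg _)] at h3
      linarith [gaussianProfile_le (smoothTruncation χ f k x)]
    · refine tendsto_const_nhds.congr' ?_
      filter_upwards [eventually_smoothTruncation_eventuallyEq χ (f := f) x] with k hk
      rw [hk.eq_of_nhds, hk.gradient_eq]
  exact le_of_tendsto_of_tendsto' ((continuous_gaussianProfile.tendsto _).comp hlim) hlim' fun k =>
    gaussianProfile_integral_le_of_hasCompactSupport (contDiff_smoothTruncation χ hf k)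
      (smoothTruncation_mem_Icc χ hf01 k) (hasCompactSupport_smoothTruncation χ k)

theorem mainTheorem1 (n : ℕ) (f : EuclideanSpace ℝ (Fin n) → ℝ) (hf : ContDiff ℝ 1 f)
    (hf01 : ∀ x, f x ∈ Set.Icc (0 : ℝ) 1) :
    ENNReal.ofReal (gaussianProfile (∫ x, f x ∂(stdGaussian (EuclideanSpace ℝ (Fin n))))) ≤
      ∫⁻ x, ENNReal.ofReal (Real.sqrt (gaussianProfile (f x) ^ 2 + ‖∇ f x‖ ^ 2))
        ∂(stdGaussian (EuclideanSpace ℝ (Fin n))) := by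
  have h0 : 0 ≤ᵐ[stdGaussian (EuclideanSpace ℝ (Fin n))]
      fun x => √(gaussianProfile (f x) ^ 2 + ‖∇ f x‖ ^ 2) :=
    ae_of_all _ fun x => Real.sqrt_nonneg _
  by_cases htop : ∫⁻ x, ENNReal.ofReal (√(gaussianProfile (f x) ^ 2 + ‖∇ f x‖ ^ 2))
      ∂(stdGaussian (EuclideanSpace ℝ (Fin n))) = ⊤
  · rw [htop]
    exact le_top
  have hi : Integrable (fun x => √(gaussianProfile (f x) ^ 2 + ‖∇ f x‖ ^ 2))
      (stdGaussian (EuclideanSpace ℝ (Fin n))) :=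
    ⟨(continuous_sqrt_profile_sq_add hf).aestronglyMeasurable,
      (hasFiniteIntegral_iff_ofReal h0).2 (lt_top_iff_ne_top.2 htop)⟩
  rw [← ofReal_integral_eq_lintegral_ofReal hi h0]
  exact ENNReal.ofReal_le_ofReal (gaussianProfile_integral_le_of_integrable hf hf01 hi)
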